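/- Let $\mathcal{A}$ be an abelian category and $D^b(\mathcal{A})$ its bounded derived category. For a class $\mathcal{U}$ of objects of $\mathcal{A}$ let $\operatorname{add}\mathcal{U}$ be the full subcategory of direct summands of finite direct sums of objects in $\mathcal{U}$. Put $[\mathcal{U}]_0=0$, $[\mathcal{U}]_1=\operatorname{add}\mathcal{U}$, and, for $n\ge 2$, let $[\mathcal{U}]_n$ be $\operatorname{add}$ of the class of all $M\in\mathcal{A}$ for which there is an exact sequence $0\to U\to M\to V\to 0$ with $U\in[\mathcal{U}]_1$ and $V\in[\mathcal{U}]_{n-1}$. Let $$\operatorname{ext.dim}\mathcal{A}=\inf\{n\ge 0\mid \mathcal{A}=[X]_{n+1}\text{ for some }X\in\mathcal{A}\}.$$ For a triangulated category $\mathcal{T}$ with shift $[1]$ and a class $\mathcal{I}$ of objects of $\mathcal{T}$ let $\langle\mathcal{I}\rangle_1$ be the full subcategory of direct summands of finite direct sums of shifts $I[a]$ ($I\in\mathcal{I}$, $a\in\mathbb{Z}$). Put $\langle\mathcal{I}\rangle_0=0$ and, for $n\ge1$, $\langle\mathcal{I}\rangle_{n+1}=\langle\,\langle\mathcal{I}\rangle_n*\langle\mathcal{I}\rangle_1\,\rangle_1$,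 where $\mathcal{I}_1*\mathcal{I}_2$ is the class of all $X$ for which there is a distinguished triangle $X_1\to X\to X_2\to X_1[1]$ with $X_i\in\mathcal{I}_i$. Let $$\dim\mathcal{T}=\inf\{n\ge0\mid\mathcal{T}=\langle T\rangle_{n+1}\text{ for some }T\in\mathcal{T}\},\qquad \dim_{\mathcal{T}}\mathcal{C}=\inf\{n\ge0\mid\mathcal{C}\subseteq\langle T\rangle_{n+1}\text{ for some }T\in\mathcal{T}\}$$ for a subcategory $\mathcal{C}$ of $\mathcal{T}$. Put $\operatorname{der.dim}\mathcal{A}=\dim D^b(\mathcal{A})$, and let $\dim_{D^b(\mathcal{A})}\mathcal{A}$ be the dimension in $D^b(\mathcal{A})$ of $\mathcal{A}$, viewed as the subcategory of stalk complexes in degree zero. All these dimensions take values in $\mathbb{N}\cup\{\infty\}$, with $\inf\emptyset=\infty$. **Theorem.** For every abelian category $\mathcal{A}$, $$\dim_{D^b(\mathcal{A})}\mathcal{A}\ \le\ \operatorname{der.dim}\mathcal{A}\ \le\ 2\dim_{D^b(\mathcal{A})}\mathcal{A}+1\ \le\ 2\operatorname{ext.dim}\mathcal{A}+1 .$$ 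-/

import Mathlib

universe w v u

open CategoryTheory CategoryTheory.Limits CategoryTheory.Pretriangulated

noncomputable section

namespace DerExtDim

section Abelian

variable {A : Type u} [Category.{v} A] [Abelian A]

attribute [local instance] Abelian.hasFiniteBiproducts

/-- `add P`: the direct summands of finite direct sums (the empty one included) of objects
satisfying `P`. Direct summands are expressed as retracts; this is the same thing in an
abelian category. -/
def addHull (P : ObjectProperty A) : ObjectProperty A := fun X =>
  ∃ (n : ℕ) (Y : Fin n → A), (∀ i, P (Y i)) ∧ Nonempty (Retract X (⨁ Y))

/-- The middle terms `M` of short exact sequences `0 ⟶ U₁ ⟶ M ⟶ U₂ ⟶ 0` with `U₁` in `P₁`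
and `U₂` in `P₂`. -/
def middleTerms (P₁ P₂ : ObjectProperty A) : ObjectProperty A := fun M =>
  ∃ (U₁ U₂ : A) (f : U₁ ⟶ M) (g : M ⟶ U₂) (h : f ≫ g = 0),
    P₁ U₁ ∧ P₂ U₂ ∧ (ShortComplex.mk f g h).ShortExact

/-- `P₁ • P₂` -/
def bullet (P₁ P₂ : ObjectProperty A) : ObjectProperty A := addHull (middleTerms P₁ P₂)

/-- `[P]₀ = 0`, `[P]₁ = add P` and `[P]ₙ = [P]₁ • [P]ₙ₋₁` for `n ≥ 2`. -/
def extPow (P : ObjectProperty A) : ℕ → ObjectProperty A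
  | 0 => fun X => IsZero X
  | 1 => addHull P
  | n + 2 => bullet (addHull P) (extPow P (n + 1))

variable (A) in
/-- The extension dimension of the abelian category `A`: the infimum in `ℕ∞` of all `n` such that
`A = [X]ₙ₊₁` for some object `X`; it is `⊤` if there is no such `n`. -/
def extdim : ℕ∞ :=
  sInf {d : ℕ∞ | ∃ n : ℕ, d = n ∧
    ∃ X : A, ∀ M : A, extPow (ObjectProperty.singleton X) (n + 1) M}

end Abelian

section Triangulated

variable {T : Type u} [Category.{v} T] [HasZeroObject T] [HasShift T ℤ] [Preadditive T]
  [∀ n : ℤ, (shiftFunctor T n).Additive] [Pretriangulated T]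

/-- `⟨I⟩₁`: the direct summands (expressed as retracts) of finite direct sums of shifts of objects
in `I`. -/
def angle (I : ObjectProperty T) : ObjectProperty T := fun X =>
  ∃ (n : ℕ) (Y : Fin n → T) (a : Fin n → ℤ), (∀ i, I (Y i)) ∧
    Nonempty (Retract X (⨁ fun i => (Y i)⟦a i⟧))

/-- `I₁ ⋄ I₂ = ⟨I₁ * I₂⟩₁`, where `I₁ * I₂` consists of the objects `X` in distinguished
triangles `X₁ ⟶ X ⟶ X₂ ⟶ X₁⟦1⟧` with `X₁` in `I₁` and `X₂` in `I₂`. -/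
def diamond (I₁ I₂ : ObjectProperty T) : ObjectProperty T :=
  angle (ObjectProperty.extensionProduct I₁ I₂)

/-- `⟨I⟩₀ = 0`, `⟨I⟩₁` and `⟨I⟩ₙ₊₁ = ⟨I⟩ₙ ⋄ ⟨I⟩₁` for `n ≥ 1`. -/
def anglePow (I : ObjectProperty T) : ℕ → ObjectProperty T
  | 0 => fun X => IsZero X
  | 1 => angle I
  | n + 2 => diamond (anglePow I (n + 1)) (angle I)

/-- The dimension `dim_T C` of a subcategory `C` of a triangulated category `T`: the infimum in
`ℕ∞` of all `n` such that `C ⊆ ⟨X⟩ₙ₊₁` for some object `X` of `T`. -/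
def dimIn (C : ObjectProperty T) : ℕ∞ :=
  sInf {d : ℕ∞ | ∃ n : ℕ, d = n ∧
    ∃ X : T, C ≤ anglePow (ObjectProperty.singleton X) (n + 1)}

variable (T) in
/-- The (Rouquier) dimension of a triangulated category `T`: the infimum in `ℕ∞` of all `n` such
that `T = ⟨X⟩ₙ₊₁` for some object `X`. -/
def triangDim : ℕ∞ :=
  sInf {d : ℕ∞ | ∃ n : ℕ, d = n ∧
    ∃ X : T, anglePow (ObjectProperty.singleton X) (n + 1) = ⊤}

end Triangulated

section Derived

variable (A : Type u) [Category.{v} A] [Abelian A] [HasDerivedCategory.{w} A]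

/-- The functor `A ⥤ Dᵇ(A)` which sends an object to the stalk complex in degree zero. -/
def stalk : A ⥤ DerivedCategory.Bounded A :=
  (DerivedCategory.TStructure.t (C := A)).bounded.lift (DerivedCategory.singleFunctor A 0)
    (fun _ => ⟨⟨0, inferInstance⟩, ⟨0, inferInstance⟩⟩)

/-- The derived dimension of `A`: the dimension of the bounded derived category. -/
def derdim : ℕ∞ := triangDim (DerivedCategory.Bounded A)

/-- The dimension of `A` inside `Dᵇ(A)`, the objects of `A` being viewed as stalk complexes in
degree zero. -/
def stalkDim : ℕ∞ := dimIn (stalk A).essImage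

end Derived

end DerExtDim

end

/-! For a bounded complex `K`, both the cycles `Z` and the quotient `K/Z` have zero differentials,
so each is a finite sum of shifted stalks. Thus every object of `Dᵇ(A)` lies in `⟨A⟩₁ * ⟨A⟩₁`
(`extensionProduct_angle_stalk_essImage`). If `A ⊆ ⟨X⟩ₙ₊₁`, then `⟨A⟩₁ ⊆ ⟨X⟩ₙ₊₁`, and
`extensionProduct_anglePow_le` puts everything in `⟨X⟩₂ₙ₊₂`. For the last inequality, short exact
sequences become triangles, so `[X]ₙ₊₁` lands in `⟨X⟩ₙ₊₁` (`extPow_le_inverseImage_stalk`). -/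

noncomputable section

namespace DerExtDim

/-! ### Calculus of `⟨I⟩ₙ` in a triangulated category. -/

section Triangulated

variable {T : Type u} [Category.{v} T] [HasZeroObject T] [HasShift T ℤ] [Preadditive T]
  [∀ n : ℤ, (shiftFunctor T n).Additive] [Pretriangulated T]

/-- An object whose identity is a finite sum of endomorphisms, each factoring through a shift of an
object of `I`, belongs to `angle I`. -/
lemma angle_of_sum_eq_id (I : ObjectProperty T) {κ : Type*} [Fintype κ] {X : T}
    (Y : κ → T) (a : κ → ℤ) (hY : ∀ k, I (Y k))
    (p : ∀ k, X ⟶ (Y k)⟦a k⟧) (q : ∀ k, (Y k)⟦a k⟧ ⟶ X) (h : ∑ k, p k ≫ q k = 𝟙 X) :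
    angle I X := by
  let e := (Fintype.equivFin κ).symm
  refine ⟨Fintype.card κ, fun i => Y (e i), fun i => a (e i), fun i => hY _,
    ⟨⟨biproduct.lift fun i => p (e i), biproduct.desc fun i => q (e i), ?_⟩⟩⟩
  rw [biproduct.lift_desc, ← h]
  exact e.sum_comp fun k => p k ≫ q k

/-- Decompositions of the identity pass through shifts and finite products by plain composition, so
nested biproducts are never compared. -/
lemma exists_sum_eq_id_of_angle {I : ObjectProperty T} {X : T} (hX : angle I X) :
    ∃ (n : ℕ) (Y : Fin n → T) (a : Fin n → ℤ) (_ : ∀ k, I (Y k))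
      (p : ∀ k, X ⟶ (Y k)⟦a k⟧) (q : ∀ k, (Y k)⟦a k⟧ ⟶ X), ∑ k, p k ≫ q k = 𝟙 X := by
  obtain ⟨n, Y, a, hY, ⟨r⟩⟩ := hX
  refine ⟨n, Y, a, hY, fun k => r.i ≫ biproduct.π _ k, fun k => biproduct.ι (fun k => (Y k)⟦a k⟧) k ≫ r.r, ?_⟩
  have : r.i ≫ (∑ k, biproduct.π (fun k => (Y k)⟦a k⟧) k ≫
      biproduct.ι (fun k => (Y k)⟦a k⟧) k) ≫ r.r = 𝟙 X := by
    rw [biproduct.total, Category.id_comp, r.retract]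
  simpa only [Preadditive.sum_comp, Preadditive.comp_sum, Category.assoc] using this

instance (I : ObjectProperty T) : (angle I).IsStableUnderRetracts where
  of_retract := by
    rintro X Z r ⟨n, Y, a, hY, ⟨s⟩⟩
    exact ⟨n, Y, a, hY, ⟨r.trans s⟩⟩

instance (I : ObjectProperty T) : (angle I).IsStableUnderShift ℤ where
  isStableUnderShiftBy b :=
    { le_shift := by
        intro X hX
        obtain ⟨n, Y, a, hY, p, q, h⟩ := exists_sum_eq_id_of_angle hX
        refine angle_of_sum_eq_id I Y (fun k => a k + b) hY
          (fun k => (p k)⟦b⟧' ≫ (shiftFunctorAdd T (a k) b).inv.app (Y k))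
          (fun k => (shiftFunctorAdd T (a k) b).hom.app (Y k) ≫ (q k)⟦b⟧') ?_
        simp [← Functor.map_comp, ← Functor.map_sum, h] }

instance (I : ObjectProperty T) : (angle I).IsClosedUnderFiniteProducts :=
  ⟨fun J _ => by
    refine ⟨?_⟩
    rintro X ⟨⟨⟨F, c, hc⟩, hF⟩⟩
    have := Fintype.ofFinite J
    choose n Y a hY p q h using fun j => exists_sum_eq_id_of_angle (hF ⟨j⟩)
    refine (angle I).prop_of_iso (biproduct.isoProduct (fun j => F.obj ⟨j⟩) ≪≫
      HasLimit.isoOfNatIso (Discrete.natIsoFunctor (F := F)).symm ≪≫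
      (limit.isLimit F).conePointUniqueUpToIso hc) ?_
    refine angle_of_sum_eq_id I (κ := Σ j, Fin (n j)) (fun k => Y k.1 k.2) (fun k => a k.1 k.2)
      (fun k => hY k.1 k.2) (fun k => biproduct.π _ k.1 ≫ p k.1 k.2)
      (fun k => q k.1 k.2 ≫ biproduct.ι (fun j => F.obj ⟨j⟩) k.1) ?_
    rw [Fintype.sum_sigma, ← biproduct.total]
    refine Finset.sum_congr rfl fun j _ => ?_
    have := congr(biproduct.π (fun j => F.obj ⟨j⟩) j ≫ $(h j) ≫
      biproduct.ι (fun j => F.obj ⟨j⟩) j)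
    simpa [Preadditive.sum_comp, Preadditive.comp_sum] using this⟩

lemma le_angle (I : ObjectProperty T) : I ≤ angle I := fun X hX =>
  angle_of_sum_eq_id I (κ := Unit) (fun _ => X) (fun _ => 0) (fun _ => hX)
    (fun _ => (shiftFunctorZero T ℤ).inv.app X) (fun _ => (shiftFunctorZero T ℤ).hom.app X)
    (by simp)

lemma angle_le_iff (I P : ObjectProperty T) [P.IsStableUnderShift ℤ]
    [P.IsClosedUnderFiniteProducts] [P.IsStableUnderRetracts] : angle I ≤ P ↔ I ≤ P := by
  refine ⟨(le_angle I).trans, fun h => ?_⟩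
  rintro X ⟨n, Y, a, hY, ⟨r⟩⟩
  exact P.prop_of_retract r (P.prop_of_iso (biproduct.isoProduct _).symm
    (P.prop_product fun i => P.le_shift _ _ (h _ (hY i))))

/-- With shifts and finite products already present, only summands are missing. Applied to extension
products, this reduces `diamond` to a retract closure. -/
lemma angle_eq_retractClosure (P : ObjectProperty T) [P.IsStableUnderShift ℤ]
    [P.IsClosedUnderFiniteProducts] : angle P = P.retractClosure := by
  refine le_antisymm ?_ (P.retractClosure_le_iff _ |>.2 (le_angle P))
  rintro X ⟨n, Y, a, hY, ⟨r⟩⟩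
  exact P.prop_retractClosure (P.prop_product fun i => P.le_shift (a i) _ (hY i))
    (r.trans (biproduct.isoProduct _).retract)

instance (P Q : ObjectProperty T) [P.IsClosedUnderFiniteProducts]
    [Q.IsClosedUnderFiniteProducts] :
    (ObjectProperty.extensionProduct P Q).IsClosedUnderFiniteProducts :=
  ⟨fun J _ => by
    refine ⟨?_⟩
    rintro X ⟨⟨⟨F, c, hc⟩, hF⟩⟩
    choose Y Z f g h hT hY hZ using fun j : J => hF ⟨j⟩
    refine ObjectProperty.prop_of_iso _
      (HasLimit.isoOfNatIso (Discrete.natIsoFunctor (F := F)).symm ≪≫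
      (limit.isLimit F).conePointUniqueUpToIso hc) ?_
    exact ⟨_, _, _, _, _, productTriangle_distinguished _ hT, P.prop_product hY,
      Q.prop_product hZ⟩⟩

instance (I : ObjectProperty T) (n : ℕ) : (anglePow I (n + 1)).IsStableUnderShift ℤ := by
  cases n <;> exact inferInstanceAs ((angle _).IsStableUnderShift ℤ)

instance (I : ObjectProperty T) (n : ℕ) :
    (anglePow I (n + 1)).IsClosedUnderFiniteProducts := by
  cases n <;> exact inferInstanceAs (angle _).IsClosedUnderFiniteProducts

instance (I : ObjectProperty T) (n : ℕ) : (anglePow I (n + 1)).IsStableUnderRetracts := by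
  cases n <;> exact inferInstanceAs (angle _).IsStableUnderRetracts

lemma anglePow_succ (I : ObjectProperty T) (n : ℕ) :
    anglePow I (n + 2) =
      (ObjectProperty.extensionProduct (anglePow I (n + 1)) (angle I)).retractClosure :=
  angle_eq_retractClosure _

variable [IsTriangulated T]

/-- Summands taken at intermediate stages can be postponed to the end, leaving iterated extensions
of `angle I`, which are associative by the octahedral axiom. -/
lemma anglePow_eq_retractClosure (I : ObjectProperty T) (n : ℕ) :
    anglePow I (n + 1) = ((angle I).extensionProductIter n).retractClosure := by
  induction n with
  | zero => exact ((angle I).retractClosure_eq_self).symm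
  | succ n hn =>
    rw [anglePow_succ, hn, ObjectProperty.extensionProductIter_succ',
      ← ObjectProperty.retractClosure_extensionProduct_retractClosure_retractClosure _ (angle I),
      ← ObjectProperty.retractClosure_extensionProduct_retractClosure_retractClosure _ (angle I)]
    simp

lemma extensionProduct_anglePow_le (I : ObjectProperty T) (m n : ℕ) :
    ObjectProperty.extensionProduct (anglePow I (m + 1)) (anglePow I (n + 1)) ≤
      anglePow I (m + n + 2) := by
  rw [anglePow_eq_retractClosure, anglePow_eq_retractClosure,
    -- `extensionProductIter n` has `n + 1` factors, so `m + 1` and `n + 1` factors together have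
    -- index `m + 1 + n`.
    show m + n + 2 = (m + 1 + n) + 1 by lia, anglePow_eq_retractClosure,
    ObjectProperty.extensionProductIter_add _ (rfl : m + 1 = m + 1)]
  exact ObjectProperty.extensionProduct_retractClosure_retractClosure_le _ _

end Triangulated

/-! ### Triangles in a triangulated subcategory. -/

section FullSubcategory

variable {T : Type u} [Category.{v} T] [HasZeroObject T] [HasShift T ℤ] [Preadditive T]
  [∀ n : ℤ, (shiftFunctor T n).Additive] [Pretriangulated T]

/-- Distinguished triangles between objects of a triangulated subcategory lift to it. -/
lemma extensionProduct_of_ι_distinguished (P : ObjectProperty T) [P.IsTriangulated]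
    {I₁ I₂ : ObjectProperty P.FullSubcategory} {X₁ X₂ X₃ : P.FullSubcategory}
    (f : X₁.obj ⟶ X₂.obj) (g : X₂.obj ⟶ X₃.obj) (h : X₃.obj ⟶ X₁.obj⟦(1 : ℤ)⟧)
    (hT : Triangle.mk f g h ∈ distTriang T) (h₁ : I₁ X₁) (h₃ : I₂ X₃) :
    ObjectProperty.extensionProduct I₁ I₂ X₂ :=
  ⟨X₁, X₃, P.fullyFaithfulι.preimage f, P.fullyFaithfulι.preimage g,
    P.fullyFaithfulι.preimage (h ≫ (P.ι.commShiftIso (1 : ℤ)).inv.app X₁),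
    isomorphic_distinguished _ hT _
      (Triangle.isoMk _ _ (Iso.refl _) (Iso.refl _) (Iso.refl _)
        ((Category.comp_id _).trans (Category.id_comp _).symm)
        ((Category.comp_id _).trans (Category.id_comp _).symm) (by
          refine (congrArg (_ ≫ ·) (CategoryTheory.Functor.map_id _ _)).trans
            ((Category.comp_id _).trans (Eq.trans ?_ (Category.id_comp _).symm))
          change (h ≫ (P.ι.commShiftIso (1 : ℤ)).inv.app X₁) ≫
            (P.ι.commShiftIso (1 : ℤ)).hom.app X₁ = h
          rw [Category.assoc, Iso.inv_hom_id_app]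
          exact Category.comp_id h)), h₁, h₃⟩

end FullSubcategory

/-! ### Cycles and complexes with zero differentials. -/

section Cycles

open HomologicalComplex

variable {A : Type u} [Category.{v} A] [Abelian A]

/-- The subcomplex of cycles of a cochain complex, with zero differentials. -/
@[simps]
def cyclesComplex (K : CochainComplex A ℤ) : CochainComplex A ℤ where
  X n := K.cycles n
  d _ _ := 0

/-- The inclusion of the subcomplex of cycles. -/
@[simps]
def cyclesComplexι (K : CochainComplex A ℤ) : cyclesComplex K ⟶ K where
  f n := K.iCycles n
  comm' i j _ := (K.iCycles_d i j).trans zero_comp.symm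

instance (K : CochainComplex A ℤ) (n : ℤ) : Mono ((cyclesComplexι K).f n) :=
  inferInstanceAs (Mono (K.iCycles n))

instance (K : CochainComplex A ℤ) : Mono (cyclesComplexι K) :=
  mono_of_mono_f _ inferInstance

/-- The differential of `K` factors through the cycles, which vanish in the quotient. -/
lemma cokernel_cyclesComplexι_d (K : CochainComplex A ℤ) (i j : ℤ) :
    (cokernel (cyclesComplexι K)).d i j = 0 := by
  rw [← cancel_epi ((cokernel.π (cyclesComplexι K)).f i), (cokernel.π (cyclesComplexι K)).comm,
    ← K.toCycles_i, Category.assoc, comp_zero]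
  have : K.iCycles j ≫ (cokernel.π (cyclesComplexι K)).f j = 0 :=
    congr_hom (cokernel.condition (cyclesComplexι K)) j
  rw [this, comp_zero]

lemma shortExact_cyclesComplexι (K : CochainComplex A ℤ) :
    (ShortComplex.mk (cyclesComplexι K) (cokernel.π _) (cokernel.condition _)).ShortExact where
  exact := ShortComplex.exact_cokernel _

/-- The identity of a strictly bounded complex with zero differentials is the sum of its
components, which factor through single complexes. -/
lemma sum_mkHomToSingle_comp_mkHomFromSingle (K : CochainComplex A ℤ) (a b : ℤ)
    [K.IsStrictlyGE a] [K.IsStrictlyLE b] (hK : ∀ i j, K.d i j = 0) :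
    ∑ i : Finset.Icc a b, mkHomToSingle (j := i.1) (𝟙 (K.X i)) (by simp [hK]) ≫
      mkHomFromSingle (𝟙 (K.X i)) (by simp [hK]) = 𝟙 K := by
  ext n
  by_cases hn : n ∈ Finset.Icc a b
  · rw [← HomologicalComplex.eval_map, Functor.map_sum, Finset.sum_eq_single ⟨n, hn⟩]
    · simp
    · intro i _ hi
      rw [Functor.map_comp]
      exact (congrArg (· ≫ _) ((isZero_single_obj_X (ComplexShape.up ℤ) i.1 (K.X i) n
        (fun h => hi (Subtype.ext h.symm))).eq_zero_of_tgt _)).trans zero_comp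
    · simp
  · refine IsZero.eq_of_src ?_ _ _
    rw [Finset.mem_Icc, not_and_or, not_le, not_le] at hn
    rcases hn with hn | hn
    · exact K.isZero_of_isStrictlyGE a n hn
    · exact K.isZero_of_isStrictlyLE b n hn

end Cycles

/-! ### The bounded derived category and the inequalities. -/

section Derived

variable {A : Type u} [Category.{v} A] [Abelian A] [HasDerivedCategory.{w} A]

attribute [local instance] Abelian.hasFiniteBiproducts

instance : (stalk A).Additive where
  map_add {X Y f g} := by
    ext
    exact (DerivedCategory.singleFunctor A 0).map_add

lemma bounded_Q_obj (K : CochainComplex A ℤ) (a b : ℤ) [K.IsStrictlyGE a] [K.IsStrictlyLE b] :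
    (DerivedCategory.TStructure.t (C := A)).bounded (DerivedCategory.Q.obj K) :=
  ⟨⟨a, inferInstance⟩, ⟨b, inferInstance⟩⟩

lemma extensionProduct_stalk {S : ShortComplex A} (hS : S.ShortExact)
    {I₁ I₂ : ObjectProperty (DerivedCategory.Bounded A)}
    (h₁ : I₁ ((stalk A).obj S.X₁)) (h₂ : I₂ ((stalk A).obj S.X₃)) :
    ObjectProperty.extensionProduct I₁ I₂ ((stalk A).obj S.X₂) :=
  extensionProduct_of_ι_distinguished _ (X₁ := (stalk A).obj S.X₁)
    (X₃ := (stalk A).obj S.X₃) hS.singleTriangle.mor₁ hS.singleTriangle.mor₂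
    hS.singleTriangle.mor₃ hS.singleTriangle_distinguished h₁ h₂

/-- The complex with only nonzero term `X` in degree `i` is `X⟦-i⟧` in the derived category. -/
def stalkShiftIso (X : A) (i : ℤ) :
    (DerivedCategory.Bounded.ι (C := A)).obj (((stalk A).obj X)⟦-i⟧) ≅
      DerivedCategory.Q.obj ((HomologicalComplex.single A (ComplexShape.up ℤ) i).obj X) :=
  ((DerivedCategory.Bounded.ι (C := A)).commShiftIso (-i)).app _ ≪≫
    ((DerivedCategory.singleFunctors A).shiftIso (-i) i 0 (by simp)).app X ≪≫
    (DerivedCategory.singleFunctorIsoCompQ A i).app X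

/-- The decomposition of the identity exists already for complexes; `Q` carries it to the derived
category and full faithfulness lifts it to the bounded part. -/
lemma angle_stalk_essImage_of_d_eq_zero (K : CochainComplex A ℤ) (a b : ℤ)
    [K.IsStrictlyGE a] [K.IsStrictlyLE b] (hK : ∀ i j, K.d i j = 0) :
    angle (stalk A).essImage ⟨DerivedCategory.Q.obj K, bounded_Q_obj K a b⟩ := by
  let F := (DerivedCategory.TStructure.t (C := A)).bounded.fullyFaithfulι
  refine angle_of_sum_eq_id _ (κ := Finset.Icc a b) (fun i => (stalk A).obj (K.X i))
    (fun i => -i.1) (fun i => (stalk A).obj_mem_essImage _)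
    (fun i => F.preimage (DerivedCategory.Q.map
      (HomologicalComplex.mkHomToSingle (j := i.1) (𝟙 (K.X i)) (by simp [hK])) ≫
        (stalkShiftIso (K.X i) i).inv))
    (fun i => F.preimage ((stalkShiftIso (K.X i) i).hom ≫ DerivedCategory.Q.map
      (HomologicalComplex.mkHomFromSingle (𝟙 (K.X i)) (by simp [hK])))) ?_
  apply F.map_injective
  rw [Functor.map_sum]
  simp only [Functor.map_comp, F.map_preimage, Category.assoc, Iso.inv_hom_id_assoc]
  simp only [← Functor.map_comp]
  rw [← Functor.map_sum, sum_mkHomToSingle_comp_mkHomFromSingle K a b hK]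
  exact (DerivedCategory.Q (C := A)).map_id K

/-- Every bounded complex is an extension of complexes with zero differentials: the boundaries by
the cycles. -/
lemma extensionProduct_angle_stalk_essImage (X : DerivedCategory.Bounded A) :
    ObjectProperty.extensionProduct (angle (stalk A).essImage) (angle (stalk A).essImage) X := by
  obtain ⟨X, ⟨a, ha⟩, ⟨b, hb⟩⟩ := X
  have : X.IsGE a := ha
  have : X.IsLE b := hb
  obtain ⟨K, _, _, ⟨e⟩⟩ := X.exists_iso_Q_obj_of_isGE_of_isLE a b
  have hge (n : ℤ) (hn : n < a) := K.isZero_of_isStrictlyGE a n hn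
  have hle (n : ℤ) (hn : b < n) := K.isZero_of_isStrictlyLE b n hn
  have : (cyclesComplex K).IsStrictlyGE a := (CochainComplex.isStrictlyGE_iff _ _).2
    fun n hn => (hge n hn).of_mono ((cyclesComplexι K).f n)
  have : (cyclesComplex K).IsStrictlyLE b := (CochainComplex.isStrictlyLE_iff _ _).2
    fun n hn => (hle n hn).of_mono ((cyclesComplexι K).f n)
  -- The quotient by the cycles stands in for the boundaries: only its bounds and zero differential
  -- matter.
  have : (cokernel (cyclesComplexι K)).IsStrictlyGE a := (CochainComplex.isStrictlyGE_iff _ _).2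
    fun n hn => (hge n hn).of_epi ((cokernel.π (cyclesComplexι K)).f n)
  have : (cokernel (cyclesComplexι K)).IsStrictlyLE b := (CochainComplex.isStrictlyLE_iff _ _).2
    fun n hn => (hle n hn).of_epi ((cokernel.π (cyclesComplexι K)).f n)
  refine ObjectProperty.prop_of_iso _ (ObjectProperty.isoMk _ e.symm : ⟨_, bounded_Q_obj K a b⟩ ≅ _)
    ?_
  exact extensionProduct_of_ι_distinguished _
    (X₁ := ⟨_, bounded_Q_obj (cyclesComplex K) a b⟩)
    (X₃ := ⟨_, bounded_Q_obj (cokernel (cyclesComplexι K)) a b⟩) _ _ _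
    (DerivedCategory.triangleOfSES_distinguished (shortExact_cyclesComplexι K))
    (angle_stalk_essImage_of_d_eq_zero _ a b fun _ _ => rfl)
    (angle_stalk_essImage_of_d_eq_zero _ a b (cokernel_cyclesComplexι_d K))

lemma addHull_le_inverseImage_stalk {P : ObjectProperty A}
    {Q : ObjectProperty (DerivedCategory.Bounded A)} [Q.IsClosedUnderFiniteProducts]
    [Q.IsStableUnderRetracts] (h : P ≤ Q.inverseImage (stalk A)) :
    addHull P ≤ Q.inverseImage (stalk A) := by
  rintro X ⟨n, Y, hY, ⟨r⟩⟩
  exact Q.prop_of_retract ((r.map (stalk A)).trans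
    ((stalk A).mapBiproduct Y ≪≫ biproduct.isoProduct _).retract)
    (Q.prop_product fun i => h _ (hY i))

lemma extPow_le_inverseImage_stalk {P : ObjectProperty A}
    {I : ObjectProperty (DerivedCategory.Bounded A)} (h : P ≤ I.inverseImage (stalk A)) (n : ℕ) :
    extPow P (n + 1) ≤ (anglePow I (n + 1)).inverseImage (stalk A) := by
  have h₁ : addHull P ≤ (angle I).inverseImage (stalk A) :=
    addHull_le_inverseImage_stalk fun X hX => le_angle I _ (h X hX)
  induction n with
  | zero => exact h₁
  | succ n hn =>
    refine addHull_le_inverseImage_stalk ?_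
    rintro M ⟨U, V, f, g, w, hU, hV, hS⟩
    -- `extPow` adds the new factor on the left and `anglePow` on the right; the general product
    -- bound absorbs the difference.
    have := extensionProduct_anglePow_le I 0 n _ (extensionProduct_stalk hS (h₁ _ hU) (hn _ hV))
    rwa [zero_add] at this

variable (A)

lemma stalkDim_le_derdim : stalkDim A ≤ derdim A := by
  refine sInf_le_sInf ?_
  rintro _ ⟨n, rfl, X, hX⟩
  exact ⟨n, rfl, X, hX ▸ le_top⟩

lemma stalkDim_le_extdim : stalkDim A ≤ extdim A := by
  refine sInf_le_sInf ?_
  rintro _ ⟨n, rfl, X, hX⟩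
  refine ⟨n, rfl, (stalk A).obj X, ?_⟩
  rintro M ⟨Y, ⟨e⟩⟩
  refine ObjectProperty.prop_of_iso _ e (extPow_le_inverseImage_stalk ?_ n Y (hX Y))
  rintro _ ⟨⟩
  exact ObjectProperty.singleton_iff _ _ |>.2 rfl

lemma derdim_le : derdim A ≤ 2 * stalkDim A + 1 := by
  by_cases htop : stalkDim A = ⊤
  · simp [htop]
  -- A finite infimum is over a nonempty set, hence attained in `ℕ∞`.
  have hne : {d : ℕ∞ | ∃ n : ℕ, d = n ∧ ∃ X : DerivedCategory.Bounded A,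
      (stalk A).essImage ≤ anglePow (ObjectProperty.singleton X) (n + 1)}.Nonempty := by
    by_contra h
    exact htop (by rw [stalkDim, dimIn, Set.not_nonempty_iff_eq_empty.1 h, sInf_empty])
  obtain ⟨n, hn, X, hX⟩ := csInf_mem hne
  rw [stalkDim, dimIn, hn]
  -- Two factors from `⟨X⟩ₙ₊₁` give `⟨X⟩₂ₙ₊₂`, that is, dimension at most `2 * n + 1`.
  refine sInf_le ⟨2 * n + 1, by push_cast; rfl, X, top_unique fun Y _ => ?_⟩
  have hX' : angle (stalk A).essImage ≤ anglePow (ObjectProperty.singleton X) (n + 1) :=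
    (angle_le_iff _ _).2 hX
  rw [two_mul]
  refine extensionProduct_anglePow_le _ n n _ ?_
  exact ObjectProperty.monotone_extensionProduct_left _ hX' _
    (ObjectProperty.monotone_extensionProduct_right _ hX' _
      (extensionProduct_angle_stalk_essImage Y))

end Derived

end DerExtDim

end

theorem theorem3p3 (A : Type u) [CategoryTheory.Category.{v} A]
    [CategoryTheory.Abelian A] [HasDerivedCategory.{w} A] :
    DerExtDim.stalkDim A ≤ DerExtDim.derdim A ∧
      DerExtDim.derdim A ≤ 2 * DerExtDim.stalkDim A + 1 ∧
      2 * DerExtDim.stalkDim A + 1 ≤ 2 * DerExtDim.extdim A + 1 :=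
  ⟨DerExtDim.stalkDim_le_derdim A, DerExtDim.derdim_le A, by
    gcongr
    exact DerExtDim.stalkDim_le_extdim A⟩
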